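/- An abstract $n$-polytope ($n\ge 0$) is a partially ordered set with a least and a greatest face and a strictly monotone rank function with range $\{-1,0,\dots,n\}$, such that: every flag (maximal chain) contains exactly $n+2$ faces; whenever $F<G$ have ranks $j-1$ and $j+1$ there are exactly two $j$-faces $H$ with $F<H<G$; and for all $F\le G$ the flag graph of the section $G/F=\{H: F\le H\le G\}$ is connected (two flags being joined when they differ in the face of exactly one rank). Facets are the faces of rank $n-1$; a facet $F$ is identified, as a polytope, with the section of all faces $\le F$. The polytope $\mathcal P$ is regular if its automorphism group $\Gamma(\mathcal P)$ is transitive on flags; if $\rho_j$ ($0\le j\le n-1$) is the automorphism taking a base flag to the flag that differs from it in just the face of rank $j$, then $\mathcal P$ has (Schläfli) type $\{p_1,\dots,p_{n-1}\}$, where $p_j\in\{2,3,\dots\}\cup\{\infty\}$ is the period of $\rho_{j-1}\rho_j$. **Lemma 3.1.** Let $\mathcal K$ be a regular $m$-polytope of type $\{p_1,\dots,p_{m-1}\}$, finite or infinite, with facet set $A$. Then there is a regular $(m+1)$-polytope $\bar{\mathcal K}$ of type $\{p_1,\dots,p_{m-1},4\}$ (for $m=0$ both types are empty) such that: 1. every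 facet of $\bar{\mathcal K}$ is isomorphic to $\mathcal K$; 2. $\Gamma(\bar{\mathcal K})$ is isomorphic to the semidirect product $N\rtimes\Gamma(\mathcal K)$, where $N$ is the group of all finitely supported sequences $A\to C_2$ under componentwise multiplication (so $N=C_2^A$ when $A$ is finite), and $\Gamma(\mathcal K)$ acts on $N$ by permuting the coordinates as it permutes the facets of $\mathcal K$; 3. if $\mathcal K$ is finite, then $|\Gamma(\bar{\mathcal K})|=|\Gamma(\mathcal K)|\cdot 2^{|A|}$; 4. $\bar{\mathcal K}$ is finite if and only if $\mathcal K$ is finite. -/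

import Mathlib

universe u

namespace AbsPoly

/-- Two flags (maximal chains) of a ranked poset are `j`-adjacent if they are distinct and have
the same faces in every rank other than `j`. -/
def FlagAdj {P : Type u} [PartialOrder P] (rk : P → ℤ) (j : ℤ) (Φ Ψ : Flag P) : Prop :=
  Φ ≠ Ψ ∧ ∀ F : P, rk F ≠ j → (F ∈ Φ ↔ F ∈ Ψ)

/-- The flag graph: two flags are joined when they are `j`-adjacent for some rank `j`. -/
def flagGraph {P : Type u} [PartialOrder P] (rk : P → ℤ) : SimpleGraph (Flag P) where
  Adj Φ Ψ := ∃ j : ℤ, FlagAdj rk j Φ Ψ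
  symm := ⟨fun _ _ ⟨j, h⟩ => ⟨j, h.1.symm, fun F hF => (h.2 F hF).symm⟩⟩
  loopless := ⟨fun _ ⟨_, h⟩ => h.1 rfl⟩

/-- `P`, with least face `⊥`, greatest face `⊤` and rank function `rk`, is an abstract
`n`-polytope. -/
structure IsPolytope {P : Type u} [PartialOrder P] [BoundedOrder P] (n : ℕ) (rk : P → ℤ) :
    Prop where
  rank_strictMono : StrictMono rk
  rank_range : Set.range rk = Set.Icc (-1 : ℤ) n
  flag_card : ∀ Φ : Flag P, (Φ : Set P).encard = n + 2
  /-- the diamond condition -/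
  diamond : ∀ (F G : P) (j : ℤ), F < G → rk F = j - 1 → rk G = j + 1 →
    {H : P | rk H = j ∧ F < H ∧ H < G}.encard = 2
  /-- strong flag-connectedness: the flag graph of each section `G/F` is connected -/
  connected : ∀ F G : P, F ≤ G →
    (flagGraph (fun H : Set.Icc F G => rk H.1)).Connected

/-- An abstract `n`-polytope is regular if its automorphism group `P ≃o P` is transitive on the
set of flags. -/
structure IsRegularPolytope {P : Type u} [PartialOrder P] [BoundedOrder P] (n : ℕ) (rk : P → ℤ) :
    Prop extends IsPolytope n rk where
  flag_transitive : ∀ Φ Ψ : Flag P, ∃ σ : P ≃o P, σ • Φ = Ψ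

/-- The period (order) of a group element, `⊤` meaning infinite period. -/
noncomputable def period {G : Type u} [Group G] (g : G) : ℕ∞ :=
  if orderOf g = 0 then ⊤ else (orderOf g : ℕ∞)

/-- The (regular) `n`-polytope `P` has Schläfli type `{p 1, …, p (n - 1)}`: for some base flag `Φ`
and automorphisms `ρ 0, …, ρ (n - 1)` taking `Φ` to its adjacent flags, the period of
`ρ (j - 1) * ρ j` is `p j` for `1 ≤ j ≤ n - 1`. Other values of `p` and `ρ` are irrelevant. -/
def HasSchlafliType {P : Type u} [PartialOrder P] (n : ℕ) (rk : P → ℤ) (p : ℕ → ℕ∞) : Prop :=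
  ∃ (Φ : Flag P) (ρ : ℕ → (P ≃o P)),
    (∀ j : ℕ, j < n → FlagAdj rk j Φ (ρ j • Φ)) ∧
    ∀ j : ℕ, 1 ≤ j → j < n → period (ρ (j - 1) * ρ j) = p j

/-- The facets of an `n`-polytope are its faces of rank `n - 1`. -/
abbrev Facet {P : Type u} (n : ℕ) (rk : P → ℤ) : Type u :=
  {F : P // rk F = (n : ℤ) - 1}

section

variable {P : Type u} [PartialOrder P] [BoundedOrder P] {n : ℕ} {rk : P → ℤ}

theorem IsPolytope.rank_le (h : IsPolytope n rk) (F : P) : rk F ≤ n := by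
  have : rk F ∈ Set.Icc (-1 : ℤ) n := h.rank_range ▸ Set.mem_range_self F
  exact this.2

theorem IsPolytope.neg_one_le_rank (h : IsPolytope n rk) (F : P) : -1 ≤ rk F := by
  have : rk F ∈ Set.Icc (-1 : ℤ) n := h.rank_range ▸ Set.mem_range_self F
  exact this.1

theorem IsPolytope.rank_top (h : IsPolytope n rk) : rk ⊤ = n := by
  have : (n : ℤ) ∈ Set.range rk := by rw [h.rank_range]; constructor <;> omega
  obtain ⟨F, hF⟩ := this
  have := h.rank_strictMono.monotone (le_top : F ≤ ⊤)
  have := h.rank_le (⊤ : P)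
  omega

/-- Every flag contains a face of each rank. -/
theorem IsPolytope.exists_mem_flag (h : IsPolytope n rk) (Φ : Flag P) {j : ℤ}
    (h1 : -1 ≤ j) (h2 : j ≤ n) : ∃ F ∈ Φ, rk F = j := by
  have hinj : Set.InjOn rk (Φ : Set P) := by
    intro a ha b hb hab
    rcases Φ.le_or_le ha hb with hl | hl
    · by_contra hne
      exact absurd hab (h.rank_strictMono (lt_of_le_of_ne hl hne)).ne
    · by_contra hne
      exact absurd hab.symm (h.rank_strictMono (lt_of_le_of_ne hl (Ne.symm hne))).ne
  have hsub : rk '' (Φ : Set P) ⊆ Set.Icc (-1 : ℤ) n := by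
    rw [← h.rank_range]; exact Set.image_subset_range _ _
  have hcard : (rk '' (Φ : Set P)).encard = n + 2 := by
    rw [hinj.encard_image, h.flag_card]
  have hIcc : (Set.Icc (-1 : ℤ) n).encard = n + 2 := by
    rw [← Finset.coe_Icc, Set.encard_coe_eq_coe_finsetCard, Int.card_Icc]
    have : ((n : ℤ) + 1 - -1).toNat = n + 2 := by omega
    rw [this]; push_cast; rfl
  have heq : rk '' (Φ : Set P) = Set.Icc (-1 : ℤ) n :=
    (Set.finite_Icc _ _).eq_of_subset_of_encard_le' hsub (by rw [hcard, hIcc])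
  have : j ∈ rk '' (Φ : Set P) := by rw [heq]; exact ⟨h1, h2⟩
  obtain ⟨F, hF, hj⟩ := this
  exact ⟨F, hF, hj⟩

/-- The facets are exactly the coatoms. -/
theorem IsPolytope.facet_iff_isCoatom (h : IsPolytope n rk) (F : P) :
    rk F = (n : ℤ) - 1 ↔ IsCoatom F := by
  have htop := h.rank_top
  constructor
  · intro hF
    refine ⟨fun h0 => by rw [h0] at hF; omega, fun G hG => ?_⟩
    by_contra hne
    have h1 := h.rank_strictMono hG
    have h2 := h.rank_strictMono (lt_top_iff_ne_top.2 hne)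
    omega
  · intro hF
    obtain ⟨Φ, hΦ⟩ := Flag.exists_mem F
    obtain ⟨G, hG, hr⟩ := h.exists_mem_flag Φ (j := (n : ℤ) - 1) (by omega) (by omega)
    have hGtop : G ≠ ⊤ := fun h0 => by rw [h0] at hr; omega
    rcases Φ.le_or_le hΦ hG with hl | hl
    · rcases hl.eq_or_lt with he | hlt
      · rw [he, hr]
      · exact absurd (hF.2 G hlt) hGtop
    · rcases hl.eq_or_lt with he | hlt
      · rw [← he, hr]
      · have h1 := h.rank_strictMono hlt
        have h2 := h.rank_strictMono (lt_top_iff_ne_top.2 hF.1)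
        omega

theorem IsPolytope.facet_map_iff (h : IsPolytope n rk) (σ : P ≃o P) (F : P) :
    rk F = (n : ℤ) - 1 ↔ rk (σ F) = (n : ℤ) - 1 := by
  rw [h.facet_iff_isCoatom, h.facet_iff_isCoatom]
  exact (σ.isCoatom_iff F).symm

/-- The permutation action of the automorphism group on the set of facets. -/
def IsPolytope.facetPerm (h : IsPolytope n rk) : (P ≃o P) →* Equiv.Perm (Facet n rk) where
  toFun σ := σ.toEquiv.subtypeEquiv (h.facet_map_iff σ)
  map_one' := by ext; rfl
  map_mul' _ _ := by ext; rfl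

end

/-- The group of finitely supported sequences `x : A → C₂`, with componentwise operation. Here
`C₂` is the additive group `ZMod 2`, written multiplicatively. It is all of `C₂ ^ A` when `A` is
finite. -/
abbrev C2Pow (A : Type u) : Type u := Multiplicative (A →₀ ZMod 2)

/-- The action of the permutations of `A` on the sequences: `(π x)(F) = x (π⁻¹ F)`. -/
noncomputable def permC2Pow (A : Type u) : Equiv.Perm A →* MulAut (C2Pow A) where
  toFun π := AddEquiv.toMultiplicative (Finsupp.domCongr π)
  map_one' := by ext x; rfl
  map_mul' _ _ := by ext x; rfl

/-- The action of the automorphism group of a polytope on `C₂ ^ A`, where `A` is the set of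
facets. -/
noncomputable def IsPolytope.facetAction {P : Type u} [PartialOrder P] [BoundedOrder P] {n : ℕ}
    {rk : P → ℤ} (h : IsPolytope n rk) : (P ≃o P) →* MulAut (C2Pow (Facet n rk)) :=
  (permC2Pow (Facet n rk)).comp h.facetPerm

end AbsPoly

/-! The extension is a coset construction. A proper face is a face `F` of `K` together with a coset
in `N` of the subgroup `N_F` of sequences supported on the facets containing `F`; faces are ordered
by `≤` in `K` and reverse inclusion of cosets, and a new greatest face is added. As `N_⊤` is
trivial, the facets are indexed by `N`. Each is a copy of `K`, and the copies `y` and `y + e_a`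
share everything below the facet `a`.

So a flag is a pair `(y, Ψ)` with `y` in `N` and `Ψ` a flag of `K`. The diamond condition is
inherited from `K`, except under the greatest face, where it says that one coordinate in `C₂` is
free. A section up to the greatest face is connected because each copy of `K` is, and because two
copies in it differ in finitely many coordinates, which can be changed one at a time
(`connected_section_top`).

The semidirect product acts by affine maps `x ↦ e + σ x`. It is transitive on the pairs `(y, Ψ)` and
acts faithfully; since an automorphism fixing a flag is trivial (`IsPolytope.eq_one_of_smul_eq`), it
is the full automorphism group. The new generator is translation by `e_a`, with `a` the base facet.
The last old generator `σ` moves `a`, so `(σ e_a)² = e_{σ a} + e_a` is a nontrivial involution and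
the new period is 4. -/

namespace AbsPoly

/-! ### Flags through a facet, and connectedness assembled from facets -/

section Flags

variable {S X : Type u} [PartialOrder S] [PartialOrder X]

/-- A set that contains precisely the elements comparable to all its members is a flag. -/
def flagOfIff (C : Set X) (h : ∀ a, a ∈ C ↔ ∀ b ∈ C, a ≤ b ∨ b ≤ a) : Flag X where
  carrier := C
  Chain' := fun a ha b hb _ => (h a).1 ha b hb
  max_chain' := fun _ hs hCs => hCs.antisymm fun a ha => (h a).2 fun _ hb =>
    hs.total ha (hCs hb)

/-- An embedding of `S` as the set of all elements below a coatom of `X`. -/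
structure IsFacetEmb [OrderTop S] [OrderTop X] (φ : S ↪o X) : Prop where
  coatom : IsCoatom (φ ⊤)
  lower : ∀ t ≤ φ ⊤, ∃ s, φ s = t

variable [OrderTop S] [OrderTop X]

/-- The flag of `X` obtained from a flag of a facet by adding the greatest element. -/
def extendFlag {φ : S ↪o X} (hφ : IsFacetEmb φ) (Ψ : Flag S) : Flag X :=
  flagOfIff (insert ⊤ (φ '' (Ψ : Set S))) fun a => by
    constructor
    · rintro (rfl | ⟨s, hs, rfl⟩) b (rfl | ⟨t, ht, rfl⟩)
      · simp
      · simp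
      · simp
      · simpa using Ψ.le_or_le hs ht
    · intro h
      by_cases hat : a = ⊤
      · exact Or.inl hat
      have ha : a ≤ φ ⊤ := by
        rcases h (φ ⊤) (Or.inr ⟨⊤, Ψ.top_mem, rfl⟩) with h1 | h1
        · exact h1
        · rcases h1.eq_or_lt with h2 | h2
          · exact h2.ge
          · exact absurd (hφ.coatom.2 a h2) hat
      obtain ⟨s, rfl⟩ := hφ.lower a ha
      refine Or.inr ⟨s, ?_, rfl⟩
      refine Flag.mem_iff_forall_le_or_ge.2 fun b hb => ?_
      simpa using h (φ b) (Or.inr ⟨b, hb, rfl⟩)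

theorem mem_extendFlag {φ : S ↪o X} (hφ : IsFacetEmb φ) {Ψ : Flag S} {a : X} :
    a ∈ extendFlag hφ Ψ ↔ a = ⊤ ∨ ∃ s ∈ Ψ, φ s = a := Iff.rfl

theorem coe_extendFlag {φ : S ↪o X} (hφ : IsFacetEmb φ) (Ψ : Flag S) :
    (extendFlag hφ Ψ : Set X) = insert ⊤ (φ '' (Ψ : Set S)) := rfl

theorem IsFacetEmb.ne_top {φ : S ↪o X} (hφ : IsFacetEmb φ) (s : S) : φ s ≠ ⊤ := fun h =>
  hφ.coatom.1 (top_le_iff.1 (h ▸ φ.monotone le_top))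

theorem map_mem_extendFlag {φ : S ↪o X} (hφ : IsFacetEmb φ) {Ψ : Flag S} {s : S} :
    φ s ∈ extendFlag hφ Ψ ↔ s ∈ Ψ := by
  rw [mem_extendFlag]
  constructor
  · rintro (h | ⟨t, ht, h⟩)
    · exact absurd h (hφ.ne_top s)
    · exact φ.injective h ▸ ht
  · exact fun h => Or.inr ⟨s, h, rfl⟩

/-- Every member of `Θ` other than `⊤` is comparable to the coatom `φ ⊤`, hence below it and in the
image of `φ`. -/
theorem exists_extendFlag_eq {φ : S ↪o X} (hφ : IsFacetEmb φ) (Θ : Flag X) (h : φ ⊤ ∈ Θ) :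
    ∃ Ψ, extendFlag hφ Ψ = Θ := by
  have hle : ∀ t ∈ Θ, t ≠ ⊤ → ∃ s, φ s = t := fun t ht hne => by
    refine hφ.lower t ?_
    rcases Θ.le_or_le ht h with h1 | h1
    · exact h1
    · rcases h1.eq_or_lt with h2 | h2
      · exact h2.ge
      · exact absurd (hφ.coatom.2 t h2) hne
  refine ⟨flagOfIff {s | φ s ∈ Θ} fun a => ?_, ?_⟩
  · constructor
    · intro ha b hb
      simpa using Θ.le_or_le ha hb
    · intro H
      refine Flag.mem_iff_forall_le_or_ge.2 fun b hb => ?_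
      by_cases hbt : b = ⊤
      · simp [hbt]
      · obtain ⟨s, rfl⟩ := hle b hb hbt
        simpa using H s hb
  · ext t
    constructor
    · rintro (rfl | ⟨s, hs, rfl⟩)
      · exact Θ.top_mem
      · exact hs
    · intro ht
      by_cases hbt : t = ⊤
      · exact Or.inl hbt
      · obtain ⟨s, rfl⟩ := hle t ht hbt
        exact Or.inr ⟨s, ht, rfl⟩

/-- In a nontrivial poset of bounded rank every flag contains a coatom. -/
theorem exists_coatom_mem_flag [Nontrivial X] {r : X → ℤ} (hr : StrictMono r) {N : ℤ}
    (hN : ∀ x, r x ≤ N) (Θ : Flag X) : ∃ c ∈ Θ, IsCoatom c := by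
  have hne : ∃ t ∈ Θ, t ≠ ⊤ := by
    by_contra! h
    obtain ⟨t, ht⟩ := exists_ne (⊤ : X)
    exact ht (h t (Flag.mem_iff_forall_le_or_ge.2 fun b hb => by simp [h b hb]))
  -- Take `c` of greatest rank among the members of `Θ` other than `⊤`. A face strictly between `c`
  -- and `⊤` would be comparable to all of `Θ`, so it would belong to `Θ` and have larger rank.
  obtain ⟨n, ⟨c, ⟨hc, hct⟩, rfl⟩, hmax⟩ := Int.exists_greatest_of_bdd
    (P := fun n => ∃ t, (t ∈ Θ ∧ t ≠ ⊤) ∧ r t = n)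
    ⟨N, by rintro _ ⟨t, _, rfl⟩; exact hN t⟩ (by
      obtain ⟨t, ht, ht'⟩ := hne
      exact ⟨r t, t, ⟨ht, ht'⟩, rfl⟩)
  refine ⟨c, hc, hct, fun d hd => ?_⟩
  by_contra hdt
  have hdΘ : d ∈ Θ := Flag.mem_iff_forall_le_or_ge.2 fun b hb => by
    by_cases hbt : b = ⊤
    · simp [hbt]
    refine Or.inr ?_
    rcases Θ.le_or_le hb hc with h1 | h1
    · exact h1.trans hd.le
    · rcases h1.eq_or_lt with h2 | h2
      · exact h2 ▸ hd.le
      · exact absurd (hmax _ ⟨b, ⟨hb, hbt⟩, rfl⟩) (not_le.2 (hr h2))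
  exact absurd (hmax _ ⟨d, ⟨hdΘ, hdt⟩, rfl⟩) (not_le.2 (hr hd))

theorem encard_extendFlag {φ : S ↪o X} (hφ : IsFacetEmb φ) (Ψ : Flag S) :
    (extendFlag hφ Ψ : Set X).encard = (Ψ : Set S).encard + 1 := by
  rw [coe_extendFlag, Set.encard_insert_of_notMem, φ.injective.encard_image]
  rintro ⟨s, -, hs⟩
  exact hφ.ne_top s hs

theorem FlagAdj.extendFlag {φ : S ↪o X} (hφ : IsFacetEmb φ) {r : X → ℤ} {r' : S → ℤ}
    (hr : ∀ s, r (φ s) = r' s) {j : ℤ} {Ψ Ψ' : Flag S} (h : FlagAdj r' j Ψ Ψ') :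
    FlagAdj r j (extendFlag hφ Ψ) (extendFlag hφ Ψ') := by
  refine ⟨fun he => h.1 ?_, fun F hF => ?_⟩
  · ext s
    exact (map_mem_extendFlag hφ).symm.trans
      ((SetLike.ext_iff.1 he _).trans (map_mem_extendFlag hφ))
  · rw [mem_extendFlag, mem_extendFlag]
    refine or_congr_right (exists_congr fun s => ?_)
    constructor
    · rintro ⟨h1, rfl⟩
      exact ⟨(h.2 s (by rwa [hr] at hF)).1 h1, rfl⟩
    · rintro ⟨h1, rfl⟩
      exact ⟨(h.2 s (by rwa [hr] at hF)).2 h1, rfl⟩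

/-- A flag of two facets in which only the greatest faces differ gives adjacent flags. -/
theorem flagAdj_extendFlag_of_agree {φ φ' : S ↪o X} (hφ : IsFacetEmb φ) (hφ' : IsFacetEmb φ')
    {r : X → ℤ} {j : ℤ} (h : r (φ ⊤) = j) (h' : r (φ' ⊤) = j) (hne : φ ⊤ ≠ φ' ⊤)
    {Ψ : Flag S} (hag : ∀ s ∈ Ψ, s ≠ ⊤ → φ s = φ' s) :
    FlagAdj r j (extendFlag hφ Ψ) (extendFlag hφ' Ψ) := by
  refine ⟨fun he => ?_, fun F hF => ?_⟩
  · have h1 : φ ⊤ ∈ extendFlag hφ' Ψ := he ▸ (map_mem_extendFlag hφ).2 Ψ.top_mem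
    rcases h1 with h1 | ⟨s, -, hs⟩
    · exact hφ.ne_top _ h1
    · have h2 : φ ⊤ < φ' ⊤ := lt_of_le_of_ne (hs ▸ φ'.monotone le_top) hne
      exact hφ'.ne_top _ (hφ.coatom.2 _ h2)
  · rw [mem_extendFlag, mem_extendFlag]
    refine or_congr_right (exists_congr fun s => and_congr_right fun hs => ?_)
    by_cases hst : s = ⊤
    · subst hst
      exact ⟨fun h1 => absurd (h1 ▸ h) hF, fun h1 => absurd (h1 ▸ h') hF⟩
    · rw [hag s hs hst]

/-- Every flag passes through some facet. Paths inside one facet come from `S`; `hY` supplies the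
steps from one facet to another. -/
theorem flagGraph_connected_of_facets {Y : Type u} (φ : Y → (S ↪o X))
    (hφ : ∀ y, IsFacetEmb (φ y)) (hcov : ∀ c, IsCoatom c → ∃ y, φ y ⊤ = c)
    {r : X → ℤ} {r' : S → ℤ} (hr : StrictMono r) {N : ℤ} (hN : ∀ x, r x ≤ N)
    (hrr : ∀ y s, r (φ y s) = r' s) (hS : (flagGraph r').Connected) [Nontrivial X]
    (hY : ∀ y y', Relation.EqvGen (fun y y' => ∃ (Ψ : Flag S) (j : ℤ),
      FlagAdj r j (extendFlag (hφ y) Ψ) (extendFlag (hφ y') Ψ)) y y') :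
    (flagGraph r).Connected := by
  have hsurj : ∀ Θ : Flag X, ∃ y Ψ, extendFlag (hφ y) Ψ = Θ := fun Θ => by
    obtain ⟨c, hc, hcc⟩ := exists_coatom_mem_flag hr hN Θ
    obtain ⟨y, rfl⟩ := hcov c hcc
    exact ⟨y, exists_extendFlag_eq (hφ y) Θ hc⟩
  have hin : ∀ y Ψ Ψ', (flagGraph r).Reachable (extendFlag (hφ y) Ψ) (extendFlag (hφ y) Ψ') := by
    intro y Ψ Ψ'
    exact (hS.preconnected Ψ Ψ').map
      (⟨extendFlag (hφ y), fun ⟨j, hj⟩ => ⟨j, hj.extendFlag (hφ y) (hrr y)⟩⟩ :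
        flagGraph r' →g flagGraph r)
  have hall : ∀ y y', ∀ Ψ Ψ', (flagGraph r).Reachable
      (extendFlag (hφ y) Ψ) (extendFlag (hφ y') Ψ') := by
    intro y y'
    induction hY y y' with
    | rel y y' h =>
      obtain ⟨Ψ₀, j, hj⟩ := h
      intro Ψ Ψ'
      exact ((hin y Ψ Ψ₀).trans (SimpleGraph.Adj.reachable ⟨j, hj⟩)).trans (hin y' Ψ₀ Ψ')
    | refl y => exact hin y
    | symm y y' _ ih => exact fun Ψ Ψ' => (ih Ψ' Ψ).symm
    | trans y y' y'' _ _ ih1 ih2 =>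
      exact fun Ψ Ψ' => (ih1 Ψ Ψ).trans (ih2 Ψ Ψ')
  have : Nonempty (Flag X) := inferInstance
  refine ⟨fun Θ Θ' => ?_⟩
  obtain ⟨y, Ψ, rfl⟩ := hsurj Θ
  obtain ⟨y', Ψ', rfl⟩ := hsurj Θ'
  exact hall y y' Ψ Ψ'

end Flags

/-! ### Isomorphism invariance of flag graphs -/

section Transport

variable {P Q : Type u} [PartialOrder P] [PartialOrder Q]

theorem mem_flag_map (e : P ≃o Q) (Φ : Flag P) (F : Q) : F ∈ Flag.map e Φ ↔ e.symm F ∈ Φ := by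
  constructor
  · rintro ⟨s, hs, rfl⟩
    simpa using hs
  · intro h
    exact ⟨_, h, by simp⟩

theorem mem_flag_smul (e : P ≃o P) (Φ : Flag P) (F : P) : F ∈ e • Φ ↔ e.symm F ∈ Φ :=
  mem_flag_map e Φ F

theorem FlagAdj.map (e : P ≃o Q) {r : P → ℤ} {r' : Q → ℤ} (h : ∀ x, r' (e x) = r x) {j : ℤ}
    {Φ Ψ : Flag P} (H : FlagAdj r j Φ Ψ) : FlagAdj r' j (Flag.map e Φ) (Flag.map e Ψ) := by
  refine ⟨fun he => H.1 ((Flag.map e).injective he), fun F hF => ?_⟩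
  rw [mem_flag_map, mem_flag_map]
  exact H.2 _ (by rwa [← h, e.apply_symm_apply])

theorem flagGraph_connected_of_orderIso (e : P ≃o Q) {r : P → ℤ} {r' : Q → ℤ}
    (h : ∀ x, r' (e x) = r x) (H : (flagGraph r).Connected) : (flagGraph r').Connected := by
  have : Nonempty (Flag Q) := inferInstance
  refine ⟨fun Φ Ψ => ?_⟩
  have := (H.preconnected ((Flag.map e).symm Φ) ((Flag.map e).symm Ψ)).map
    (⟨Flag.map e, fun ⟨j, hj⟩ => ⟨j, hj.map e h⟩⟩ : flagGraph r →g flagGraph r')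
  simpa only [RelHom.coeFn_mk, Equiv.apply_symm_apply] using this

theorem flagGraph_connected_of_subsingleton [Subsingleton P] (r : P → ℤ) :
    (flagGraph r).Connected := by
  have : Nonempty (Flag P) := inferInstance
  refine ⟨fun Φ Ψ => ?_⟩
  have : Φ = Ψ := by
    ext a
    constructor <;> intro _ <;>
      exact Flag.mem_iff_forall_le_or_ge.2 fun b _ => Or.inl (Subsingleton.elim a b).le
  rw [this]

end Transport

/-! ### Automorphisms preserve rank and act freely on flags -/

section Rigidity

variable {P : Type u} [PartialOrder P] [BoundedOrder P] {n : ℕ} {rk : P → ℤ}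

theorem IsPolytope.rank_bot (h : IsPolytope n rk) : rk ⊥ = -1 := by
  have : (-1 : ℤ) ∈ Set.range rk := by rw [h.rank_range]; constructor <;> omega
  obtain ⟨F, hF⟩ := this
  have := h.rank_strictMono.monotone (bot_le : ⊥ ≤ F)
  have := h.neg_one_le_rank (⊥ : P)
  omega

theorem IsPolytope.eq_of_mem_flag (h : IsPolytope n rk) (Φ : Flag P) {F G : P} (hF : F ∈ Φ)
    (hG : G ∈ Φ) (hr : rk F = rk G) : F = G := by
  rcases Φ.le_or_le hF hG with h1 | h1 <;> rcases h1.eq_or_lt with h2 | h2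
  · exact h2
  · exact absurd hr (h.rank_strictMono h2).ne
  · exact h2.symm
  · exact absurd hr (h.rank_strictMono h2).ne'

theorem IsPolytope.lt_of_mem_flag (h : IsPolytope n rk) (Φ : Flag P) {F G : P} (hF : F ∈ Φ)
    (hG : G ∈ Φ) (hr : rk F < rk G) : F < G := by
  rcases Φ.le_or_le hF hG with h1 | h1
  · exact lt_of_le_of_ne h1 fun he => by simp [he] at hr
  · exact absurd (h.rank_strictMono.monotone h1) (not_le.2 hr)

/-- Along a flag `rk` climbs from `-1` in steps of exactly one, while an integer-valued strictly
monotone `f` climbs by at least one. Hence `rk` is determined by the order, and automorphisms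
preserve it. -/
theorem IsPolytope.rank_le_of_strictMono (h : IsPolytope n rk) {f : P → ℤ} (hf : StrictMono f)
    (hf' : ∀ F, -1 ≤ f F) (F : P) : rk F ≤ f F := by
  obtain ⟨Φ, hΦ⟩ := Flag.exists_mem F
  have key : ∀ k : ℕ, ∀ G ∈ Φ, rk G = (k : ℤ) - 1 → rk G ≤ f G := by
    intro k
    induction k with
    | zero =>
      intro G _ hr
      have := hf' G
      omega
    | succ k ih =>
      intro G hG hr
      have := h.rank_le G
      push_cast at hr
      obtain ⟨G', hG', hr'⟩ := h.exists_mem_flag Φ (j := (k : ℤ) - 1) (by omega) (by omega)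
      have h1 := ih G' hG' hr'
      have h2 := hf (h.lt_of_mem_flag Φ hG' hG (by omega))
      omega
  have := h.neg_one_le_rank F
  exact key (rk F + 1).toNat F hΦ (by omega)

theorem IsPolytope.rank_map (h : IsPolytope n rk) (σ : P ≃o P) (F : P) : rk (σ F) = rk F := by
  refine le_antisymm ?_ ?_
  · have := h.rank_le_of_strictMono (h.rank_strictMono.comp σ.symm.strictMono)
      (fun F => h.neg_one_le_rank _) (σ F)
    simpa using this
  · exact h.rank_le_of_strictMono (h.rank_strictMono.comp σ.strictMono)
      (fun F => h.neg_one_le_rank _) F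

/-- Each flag has at most one `j`-adjacent flag. -/
theorem IsPolytope.flagAdj_unique (h : IsPolytope n rk) {j : ℤ} {Φ Ψ Ψ' : Flag P}
    (h1 : FlagAdj rk j Φ Ψ) (h2 : FlagAdj rk j Φ Ψ') : Ψ = Ψ' := by
  have aux : ∀ {Θ Θ' : Flag P}, (∀ F, rk F ≠ j → (F ∈ Θ ↔ F ∈ Θ')) →
      (∀ F, rk F = j → F ∈ Θ → F ∈ Θ') → Θ = Θ' := by
    intro Θ Θ' ha hb
    have hsub : (Θ : Set P) ⊆ Θ' := fun F hF => by
      by_cases hj : rk F = j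
      · exact hb F hj hF
      · exact (ha F hj).1 hF
    exact SetLike.coe_injective (Θ.maxChain.2 Θ'.chain_le hsub)
  -- In the other ranks the only possible faces are `⊥` and `⊤`, which lie in every flag, so no two
  -- flags are `j`-adjacent.
  have hbd : 0 ≤ j ∧ j < n := by
    by_contra hcon
    refine h1.1 (aux h1.2 fun F hF hm => ?_)
    have hF1 := h.neg_one_le_rank F
    have hF2 := h.rank_le F
    rcases (show j = -1 ∨ j = n by omega) with hj | hj
    · obtain rfl : F = ⊥ := by
        by_contra hne
        have := h.rank_strictMono (bot_lt_iff_ne_bot.2 hne)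
        have := h.rank_bot
        omega
      exact Ψ.bot_mem
    · obtain rfl : F = ⊤ := by
        by_contra hne
        have := h.rank_strictMono (lt_top_iff_ne_top.2 hne)
        have := h.rank_top
        omega
      exact Ψ.top_mem
  obtain ⟨A, hA, rA⟩ := h.exists_mem_flag Φ (j := j - 1) (by omega) (by omega)
  obtain ⟨B, hB, rB⟩ := h.exists_mem_flag Φ (j := j + 1) (by omega) (by omega)
  obtain ⟨H, hH, rH⟩ := h.exists_mem_flag Φ (j := j) (by omega) (by omega)
  obtain ⟨H1, hH1, rH1⟩ := h.exists_mem_flag Ψ (j := j) (by omega) (by omega)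
  obtain ⟨H2, hH2, rH2⟩ := h.exists_mem_flag Ψ' (j := j) (by omega) (by omega)
  have hAB : A < B := h.lt_of_mem_flag Φ hA hB (by omega)
  have hcard := h.diamond A B j hAB rA rB
  have mem : ∀ {Θ : Flag P} {G : P}, (∀ F, rk F ≠ j → (F ∈ Φ ↔ F ∈ Θ)) → G ∈ Θ → rk G = j →
      G ∈ {H : P | rk H = j ∧ A < H ∧ H < B} := fun {Θ G} hΘ hG rG =>
    ⟨rG, h.lt_of_mem_flag Θ ((hΘ A (by omega)).1 hA) hG (by omega),
      h.lt_of_mem_flag Θ hG ((hΘ B (by omega)).1 hB) (by omega)⟩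
  have m0 := mem (fun F _ => Iff.rfl) hH rH
  have m1 := mem h1.2 hH1 rH1
  have m2 := mem h2.2 hH2 rH2
  have hne : ∀ {Θ : Flag P} {G : P}, FlagAdj rk j Φ Θ → G ∈ Θ → rk G = j → G ≠ H := by
    rintro Θ G hΘ hG rG rfl
    refine hΘ.1 (aux hΘ.2 fun F hF hm => ?_)
    rwa [h.eq_of_mem_flag Φ hm hH (hF.trans rG.symm)]
  have hn1 := hne h1 hH1 rH1
  have hn2 := hne h2 hH2 rH2
  -- Both differ from `H` and lie with it in the two-element set of the diamond condition.
  have h12 : H1 = H2 := by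
    obtain ⟨x, y, -, hxy⟩ := Set.encard_eq_two.1 hcard
    rw [hxy] at m0 m1 m2
    simp only [Set.mem_insert_iff, Set.mem_singleton_iff] at m0 m1 m2
    grind
  refine aux (fun F hF => (h1.2 F hF).symm.trans (h2.2 F hF)) fun F hF hm => ?_
  rw [h.eq_of_mem_flag Ψ hm hH1 (hF.trans rH1.symm), h12]
  exact hH2

theorem IsPolytope.flagGraph_connected (h : IsPolytope n rk) : (flagGraph rk).Connected := by
  refine flagGraph_connected_of_orderIso
    (⟨⟨fun x => x.1, fun x => ⟨x, bot_le, le_top⟩, fun _ => rfl, fun _ => rfl⟩, Iff.rfl⟩ :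
      Set.Icc (⊥ : P) ⊤ ≃o P) (fun _ => rfl) (h.connected ⊥ ⊤ bot_le)

/-- An automorphism of a polytope that fixes a flag is trivial. -/
theorem IsPolytope.eq_one_of_smul_eq (h : IsPolytope n rk) {σ : P ≃o P} {Φ : Flag P}
    (hσ : σ • Φ = Φ) : σ = 1 := by
  have hall : ∀ Ψ : Flag P, σ • Ψ = Ψ := by
    intro Ψ
    -- Being fixed spreads along a path: the image of a `j`-neighbour of a fixed flag is again its
    -- unique `j`-neighbour.
    obtain ⟨w⟩ := h.flagGraph_connected.preconnected Φ Ψ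
    induction w with
    | nil => exact hσ
    | @cons Φ Φ' _ hadj _ ih =>
      refine ih ?_
      obtain ⟨j, hj⟩ := hadj
      have hmap : FlagAdj rk j (σ • Φ) (σ • Φ') := hj.map σ (h.rank_map σ)
      rw [hσ] at hmap
      exact h.flagAdj_unique hmap hj
  ext F
  obtain ⟨Ψ, hΨ⟩ := Flag.exists_mem F
  refine h.eq_of_mem_flag Ψ ?_ hΨ (h.rank_map σ F)
  rw [← hall Ψ]
  exact (mem_flag_smul _ _ _).2 (by simpa using hΨ)

end Rigidity

/-! ### Proper faces as cosets -/

/-- The proper faces of the extension of `K`: a face `F` of `K` with a coset of the sequences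
supported on the facets containing `F`, represented by its member vanishing on these facets. -/
@[ext]
structure ExtFace {K : Type u} [PartialOrder K] (n : ℕ) (rk : K → ℤ) : Type u where
  face : K
  coord : Facet n rk →₀ ZMod 2
  coord_eq_zero : ∀ a, face ≤ a.1 → coord a = 0

namespace ExtFace

variable {K : Type u} [PartialOrder K] {n : ℕ} {rk : K → ℤ}

/-- Larger faces lie in fewer facets, so the condition on coordinates says that the coset of `q` is
contained in the coset of `p`. -/
instance : PartialOrder (ExtFace n rk) where
  le p q := p.face ≤ q.face ∧ ∀ a, ¬ p.face ≤ a.1 → p.coord a = q.coord a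
  le_refl _ := ⟨le_rfl, fun _ _ => rfl⟩
  le_trans _ _ _ h1 h2 := ⟨h1.1.trans h2.1, fun a ha =>
    (h1.2 a ha).trans (h2.2 a fun h => ha (h1.1.trans h))⟩
  le_antisymm p q h1 h2 := by
    have hf := le_antisymm h1.1 h2.1
    refine ExtFace.ext hf (Finsupp.ext fun a => ?_)
    by_cases ha : p.face ≤ a.1
    · rw [p.coord_eq_zero a ha, q.coord_eq_zero a (hf ▸ ha)]
    · exact h1.2 a ha

open scoped Classical in
/-- The face given by `F` and the coset of `x`. -/
noncomputable def of (F : K) (x : Facet n rk →₀ ZMod 2) : ExtFace n rk where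
  face := F
  coord := x.filter fun a => ¬ F ≤ a.1
  coord_eq_zero _ ha := Finsupp.filter_apply_neg _ _ (not_not.2 ha)

theorem coord_of (F : K) (x : Facet n rk →₀ ZMod 2) {a : Facet n rk} (ha : ¬ F ≤ a.1) :
    (of F x).coord a = x a := by
  classical exact Finsupp.filter_apply_pos _ _ ha

theorem of_le_of {F G : K} {x y : Facet n rk →₀ ZMod 2} :
    of F x ≤ of G y ↔ F ≤ G ∧ ∀ a, ¬ F ≤ a.1 → x a = y a := by
  refine and_congr_right fun h => forall_congr' fun a => forall_congr' fun ha => ?_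
  rw [coord_of F x ha, coord_of G y fun h' => ha (le_trans h h')]

theorem of_eq_of {F G : K} {x y : Facet n rk →₀ ZMod 2} :
    of F x = of G y ↔ F = G ∧ ∀ a, ¬ F ≤ a.1 → x a = y a := by
  constructor
  · intro h
    exact ⟨congrArg face h, (of_le_of.1 h.le).2⟩
  · rintro ⟨rfl, h⟩
    exact le_antisymm (of_le_of.2 ⟨le_rfl, h⟩) (of_le_of.2 ⟨le_rfl, fun a ha => (h a ha).symm⟩)

theorem of_face_coord (p : ExtFace n rk) : of p.face p.coord = p := by
  refine ExtFace.ext rfl (Finsupp.ext fun a => ?_)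
  by_cases ha : p.face ≤ a.1
  · rw [p.coord_eq_zero a ha]
    exact (of p.face p.coord).coord_eq_zero a ha
  · exact coord_of _ _ ha

theorem exists_of (p : ExtFace n rk) : ∃ F x, of F x = p := ⟨_, _, of_face_coord p⟩

theorem face_lt_face {p q : ExtFace n rk} (h : p < q) : p.face < q.face := by
  refine lt_of_le_of_ne h.le.1 fun he => ?_
  obtain ⟨F, x, rfl⟩ := exists_of p
  obtain ⟨G, y, rfl⟩ := exists_of q
  exact h.ne (of_eq_of.2 ⟨he, (of_le_of.1 h.le).2⟩)

noncomputable instance [OrderBot K] : OrderBot (ExtFace n rk) where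
  bot := of ⊥ 0
  bot_le p := by
    obtain ⟨F, x, rfl⟩ := exists_of p
    exact of_le_of.2 ⟨bot_le, fun _ ha => absurd bot_le ha⟩

instance [Finite K] : Finite (ExtFace n rk) :=
  have : Finite (Facet n rk →₀ ZMod 2) := Finite.of_injective _ DFunLike.coe_injective
  Finite.of_injective (fun p : ExtFace n rk => (p.face, p.coord)) fun _ _ h =>
    ExtFace.ext (congrArg Prod.fst h) (congrArg Prod.snd h)

end ExtFace

/-! ### The extension is a polytope -/

/-- The face poset of the extension of `K`. -/
abbrev ExtPoset {K : Type u} [PartialOrder K] (n : ℕ) (rk : K → ℤ) : Type u :=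
  WithTop (ExtFace n rk)

namespace ExtPoset

open ExtFace

variable {K : Type u} [PartialOrder K] {n : ℕ} {rk : K → ℤ}

/-- The rank function of the extension of `K`. -/
def rank : ExtPoset n rk → ℤ
  | ⊤ => n + 1
  | (p : ExtFace n rk) => rk p.face

@[simp] theorem rank_top : rank (⊤ : ExtPoset n rk) = n + 1 := rfl

/-- The copy of `K` below the facet with coordinates `y`. -/
noncomputable def facetEmb (y : Facet n rk →₀ ZMod 2) : K ↪o ExtPoset n rk :=
  OrderEmbedding.ofMapLEIff (fun F => (of F y : ExtPoset n rk)) fun F G => by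
    rw [WithTop.coe_le_coe, of_le_of]
    exact and_iff_left fun _ _ => rfl

@[simp] theorem rank_facetEmb (y : Facet n rk →₀ ZMod 2) (F : K) :
    rank (facetEmb y F) = rk F := rfl

theorem facetEmb_le {F G : K} {x y : Facet n rk →₀ ZMod 2} :
    facetEmb x F ≤ facetEmb y G ↔ F ≤ G ∧ ∀ a, ¬ F ≤ a.1 → x a = y a :=
  WithTop.coe_le_coe.trans of_le_of

theorem facetEmb_eq {F G : K} {x y : Facet n rk →₀ ZMod 2} :
    facetEmb x F = facetEmb y G ↔ F = G ∧ ∀ a, ¬ F ≤ a.1 → x a = y a :=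
  WithTop.coe_inj.trans of_eq_of

theorem eq_top_or_exists (t : ExtPoset n rk) : t = ⊤ ∨ ∃ x F, facetEmb x F = t := by
  induction t using WithTop.recTopCoe with
  | top => exact Or.inl rfl
  | coe p =>
    obtain ⟨F, x, rfl⟩ := exists_of p
    exact Or.inr ⟨x, F, rfl⟩

theorem facetEmb_ne_top (x : Facet n rk →₀ ZMod 2) (F : K) : facetEmb x F ≠ ⊤ :=
  WithTop.coe_ne_top

theorem exists_of_le_facetEmb {t : ExtPoset n rk} {y : Facet n rk →₀ ZMod 2} {G : K}
    (h : t ≤ facetEmb y G) : ∃ F ≤ G, facetEmb y F = t := by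
  rcases eq_top_or_exists t with rfl | ⟨x, F, rfl⟩
  · exact absurd (top_le_iff.1 h) (facetEmb_ne_top y G)
  · have h' := facetEmb_le.1 h
    exact ⟨F, h'.1, facetEmb_eq.2 ⟨rfl, fun a ha => (h'.2 a ha).symm⟩⟩

/-- The coordinate at `a` is invisible to faces below `a`: this is how neighbouring copies of `K`
are glued. -/
theorem facetEmb_add_single (a : Facet n rk) {s : K} (hs : s ≤ a.1) (y : Facet n rk →₀ ZMod 2)
    (b : ZMod 2) : facetEmb (y + Finsupp.single a b) s = facetEmb y s := by
  refine facetEmb_eq.2 ⟨rfl, fun a' ha' => ?_⟩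
  have : a ≠ a' := fun h => ha' (h ▸ hs)
  simp [this]

variable [BoundedOrder K]

theorem exists_eq_of_isCoatom {c : ExtPoset n rk} (hc : IsCoatom c) :
    ∃ y, facetEmb y ⊤ = c := by
  rcases eq_top_or_exists c with rfl | ⟨x, F, rfl⟩
  · exact absurd rfl hc.1
  · refine ⟨x, ?_⟩
    rcases ((facetEmb x).monotone (le_top : F ≤ ⊤)).eq_or_lt with h | h
    · exact h.symm
    · exact absurd (hc.2 _ h) (facetEmb_ne_top _ _)

section Polytope

variable (hK : IsPolytope n rk)
include hK

theorem not_top_le (a : Facet n rk) : ¬ ⊤ ≤ a.1 := fun h => by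
  have h1 := hK.rank_top
  rw [← top_le_iff.1 h, a.2] at h1
  omega

theorem top_le_iff_facetEmb {y : Facet n rk →₀ ZMod 2} {t : ExtPoset n rk} :
    facetEmb y ⊤ ≤ t ↔ t = ⊤ ∨ t = facetEmb y ⊤ := by
  constructor
  · intro h
    rcases eq_top_or_exists t with rfl | ⟨x, F, rfl⟩
    · exact Or.inl rfl
    · have h' := facetEmb_le.1 h
      refine Or.inr (facetEmb_eq.2 ⟨top_le_iff.1 h'.1, fun a _ => ?_⟩)
      exact (h'.2 a (not_top_le hK a)).symm
  · rintro (rfl | rfl)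
    · exact le_top
    · exact le_rfl

theorem facetEmb_top_injective {x y : Facet n rk →₀ ZMod 2}
    (h : facetEmb x (⊤ : K) = facetEmb y ⊤) : x = y :=
  Finsupp.ext fun a => (facetEmb_eq.1 h).2 a (not_top_le hK a)

theorem isFacetEmb (y : Facet n rk →₀ ZMod 2) : IsFacetEmb (facetEmb y : K ↪o ExtPoset n rk) where
  coatom := ⟨facetEmb_ne_top y ⊤, fun b hb =>
    ((top_le_iff_facetEmb hK).1 hb.le).resolve_right hb.ne'⟩
  lower t ht := by
    obtain ⟨F, -, h⟩ := exists_of_le_facetEmb ht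
    exact ⟨F, h⟩

theorem rank_strictMono : StrictMono (rank : ExtPoset n rk → ℤ) := by
  intro s t h
  rcases eq_top_or_exists s with rfl | ⟨x, F, rfl⟩
  · exact absurd h not_top_lt
  rcases eq_top_or_exists t with rfl | ⟨y, G, rfl⟩
  · have := hK.rank_le F
    simp only [rank_facetEmb, rank_top]
    omega
  · exact hK.rank_strictMono (face_lt_face (WithTop.coe_lt_coe.1 h))

theorem rank_le (t : ExtPoset n rk) : rank t ≤ n + 1 :=
  (rank_strictMono hK).monotone le_top

theorem exists_eq_extendFlag (Θ : Flag (ExtPoset n rk)) :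
    ∃ y Ψ, extendFlag (isFacetEmb hK y) Ψ = Θ := by
  obtain ⟨c, hc, hcc⟩ := exists_coatom_mem_flag (rank_strictMono hK) (rank_le hK) Θ
  obtain ⟨y, rfl⟩ := exists_eq_of_isCoatom hcc
  exact ⟨y, exists_extendFlag_eq (isFacetEmb hK y) Θ hc⟩

theorem le_facet_of_comparable (a : Facet n rk) {s : K} (hs : s ≠ ⊤) (h : s ≤ a.1 ∨ a.1 ≤ s) :
    s ≤ a.1 := by
  rcases h with h | h
  · exact h
  · rcases h.eq_or_lt with h | h
    · exact h.ge
    · exact absurd (((hK.facet_iff_isCoatom a.1).1 a.2).2 s h) hs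

/-- Under a proper face `t` the section is one of `K`. For `t = ⊤`, the face `s` comes from a facet
`a` of `K` and fixes every coordinate except the one at `a`, which leaves two choices. -/
theorem diamond (s t : ExtPoset n rk) (j : ℤ) (hst : s < t) (hs : rank s = j - 1)
    (ht : rank t = j + 1) : {H : ExtPoset n rk | rank H = j ∧ s < H ∧ H < t}.encard = 2 := by
  rcases eq_top_or_exists t with rfl | ⟨y, G, rfl⟩
  · rcases eq_top_or_exists s with rfl | ⟨x, F, rfl⟩
    · exact absurd hst (lt_irrefl _)
    simp only [rank_top, rank_facetEmb] at hs ht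
    have hj : j = n := by omega
    subst hj
    let a : Facet n rk := ⟨F, hs⟩
    refine Set.encard_eq_two.2 ⟨facetEmb x ⊤, facetEmb (x + Finsupp.single a 1) ⊤, fun h => ?_, ?_⟩
    · have := DFunLike.congr_fun (facetEmb_top_injective hK h) a
      simp at this
    have hF : F < ⊤ := lt_top_iff_ne_top.2 ((hK.facet_iff_isCoatom F).1 hs).1
    ext H
    simp only [Set.mem_ofPred_eq, Set.mem_insert_iff, Set.mem_singleton_iff]
    constructor
    · rintro ⟨hr, h1, h2⟩
      rcases eq_top_or_exists H with rfl | ⟨z, G, rfl⟩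
      · exact absurd h2 (lt_irrefl _)
      obtain rfl : G = ⊤ := by
        by_contra hne
        have := hK.rank_strictMono (lt_top_iff_ne_top.2 hne)
        rw [hK.rank_top] at this
        exact this.ne hr
      have h3 := (facetEmb_le.1 h1.le).2
      have hz : ∀ a', a' ≠ a → x a' = z a' := fun a' ha' => h3 a' fun hle => by
        rcases hle.eq_or_lt with h | h
        · exact ha' (Subtype.ext h.symm)
        · have := hK.rank_strictMono h
          rw [a'.2, hs] at this
          exact lt_irrefl _ this
      have hab : ∀ u v : ZMod 2, v = u ∨ v = u + 1 := by decide
      rcases hab (x a) (z a) with h | h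
      · refine Or.inl (facetEmb_eq.2 ⟨rfl, fun a' _ => ?_⟩)
        by_cases haa : a' = a
        · rw [haa, h]
        · exact (hz a' haa).symm
      · refine Or.inr (facetEmb_eq.2 ⟨rfl, fun a' _ => ?_⟩)
        by_cases haa : a' = a
        · simp [haa, h]
        · simp [Ne.symm haa, hz a' haa]
    · rintro (rfl | rfl)
      · exact ⟨hK.rank_top, (facetEmb x).strictMono hF, WithTop.coe_lt_top _⟩
      · refine ⟨hK.rank_top, ?_, WithTop.coe_lt_top _⟩
        rw [← facetEmb_add_single a (le_refl F) x 1]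
        exact (facetEmb _).strictMono hF
  · obtain ⟨F, -, rfl⟩ := exists_of_le_facetEmb hst.le
    rw [← hK.diamond F G j ((facetEmb y).lt_iff_lt.1 hst) hs ht,
      ← (facetEmb y).injective.encard_image]
    congr 1
    ext H
    constructor
    · rintro ⟨hr, h1, h2⟩
      obtain ⟨H, -, rfl⟩ := exists_of_le_facetEmb h2.le
      exact ⟨H, ⟨hr, (facetEmb y).lt_iff_lt.1 h1, (facetEmb y).lt_iff_lt.1 h2⟩, rfl⟩
    · rintro ⟨H, ⟨hr, h1, h2⟩, rfl⟩
      exact ⟨hr, (facetEmb y).lt_iff_lt.2 h1, (facetEmb y).lt_iff_lt.2 h2⟩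

end Polytope

/-- Sections of the extension below a facet are sections of `K`. -/
noncomputable def sectionIso (y : Facet n rk →₀ ZMod 2) (F G : K) :
    Set.Icc F G ≃o Set.Icc (facetEmb y F) (facetEmb y G) :=
  OrderIso.ofSurjective
    (OrderEmbedding.ofMapLEIff
      (fun s => ⟨facetEmb y s.1, (facetEmb y).monotone s.2.1, (facetEmb y).monotone s.2.2⟩)
      fun _ _ => (facetEmb y).le_iff_le) fun t => by
    obtain ⟨H, hH, h⟩ := exists_of_le_facetEmb t.2.2
    exact ⟨⟨H, (facetEmb y).le_iff_le.1 (h ▸ t.2.1), hH⟩, Subtype.ext h⟩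

/-- The facet embedding with coordinates `y`, restricted to sections with greatest face `⊤`. -/
noncomputable def sectionEmb (F : K) (x y : Facet n rk →₀ ZMod 2)
    (h : ∀ a : Facet n rk, ¬ F ≤ a.1 → x a = y a) :
    Set.Icc F ⊤ ↪o Set.Icc (facetEmb x F) ⊤ :=
  OrderEmbedding.ofMapLEIff
    (fun s => ⟨facetEmb y s.1, facetEmb_le.2 ⟨s.2.1, h⟩, le_top⟩)
    fun _ _ => (facetEmb y).le_iff_le

instance (F : K) : OrderTop (Set.Icc F ⊤) := Subtype.orderTop ⟨le_top, le_rfl⟩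

instance (s : ExtPoset n rk) : OrderTop (Set.Icc s ⊤) := Subtype.orderTop ⟨le_top, le_rfl⟩

theorem coe_sectionEmb (F : K) (x y : Facet n rk →₀ ZMod 2)
    (h : ∀ a : Facet n rk, ¬ F ≤ a.1 → x a = y a) (s : Set.Icc F ⊤) :
    (sectionEmb F x y h s : ExtPoset n rk) = facetEmb y s.1 := rfl

section Polytope

variable (hK : IsPolytope n rk)
include hK

theorem isFacetEmb_sectionEmb (F : K) (x y : Facet n rk →₀ ZMod 2)
    (h : ∀ a : Facet n rk, ¬ F ≤ a.1 → x a = y a) : IsFacetEmb (sectionEmb F x y h) where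
  coatom := ⟨fun he => facetEmb_ne_top y ⊤ (congrArg Subtype.val he), fun b hb =>
    Subtype.ext (((top_le_iff_facetEmb hK).1 (show facetEmb y ⊤ ≤ b.1 from hb.le)).resolve_right
      fun he => hb.ne' (Subtype.ext he))⟩
  lower t ht := by
    obtain ⟨G, -, hG⟩ := exists_of_le_facetEmb (show t.1 ≤ facetEmb y ⊤ from ht)
    have h1 : facetEmb x F ≤ facetEmb y G := hG ▸ t.2.1
    exact ⟨⟨G, (facetEmb_le.1 h1).1, le_top⟩, Subtype.ext hG⟩

/-- The copies of `K` in this section are those with coordinates in the coset of `x`. They are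
linked by changing coordinates at facets containing `F` one by one; finite support makes this
terminate. -/
theorem connected_section_top (F : K) (x : Facet n rk →₀ ZMod 2) :
    (flagGraph fun H : Set.Icc (facetEmb x F) ⊤ => rank H.1).Connected := by
  have : Nontrivial (Set.Icc (facetEmb x F) ⊤) :=
    ⟨⟨facetEmb x F, le_rfl, le_top⟩, ⊤, fun h => facetEmb_ne_top x F (congrArg Subtype.val h)⟩
  let Y := {y : Facet n rk →₀ ZMod 2 // ∀ a : Facet n rk, ¬ F ≤ a.1 → x a = y a}
  have hφ : ∀ y : Y, IsFacetEmb (sectionEmb F x y.1 y.2) := fun y =>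
    isFacetEmb_sectionEmb hK F x y.1 y.2
  refine flagGraph_connected_of_facets (Y := Y) (fun y => sectionEmb F x y.1 y.2) hφ
    (fun c hc => ?_) (N := n + 1) ((rank_strictMono hK).comp fun _ _ h => h)
    (fun t => rank_le hK t.1) (r' := fun H => rk H.1) (fun _ _ => rfl)
    (hK.connected F ⊤ le_top) fun y y' => ?_
  · obtain ⟨c, hc1, hc2⟩ := c
    rcases eq_top_or_exists c with rfl | ⟨y, G, rfl⟩
    · exact absurd rfl hc.1
    have hle := facetEmb_le.1 hc1
    refine ⟨⟨y, hle.2⟩, ?_⟩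
    by_contra hne
    refine facetEmb_ne_top y (⊤ : K) (congrArg Subtype.val (hc.2 _ (lt_of_le_of_ne ?_ (Ne.symm hne))))
    exact (facetEmb y).monotone le_top
  -- Induct on the difference `d` of the two coordinate sequences, which vanishes off the facets
  -- containing `F`.
  · suffices H : ∀ d : Facet n rk →₀ ZMod 2, (∀ a, ¬ F ≤ a.1 → d a = 0) → ∀ y y' : Y,
        y'.1 = y.1 + d → Relation.EqvGen (fun y y' => ∃ (Ψ : Flag (Set.Icc F ⊤)) (j : ℤ),
          FlagAdj (fun H : Set.Icc (facetEmb x F) ⊤ => rank H.1) j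
            (extendFlag (hφ y) Ψ) (extendFlag (hφ y') Ψ)) y y' by
      refine H (y'.1 - y.1) (fun a ha => ?_) y y' (by abel)
      simp [← y.2 a ha, ← y'.2 a ha]
    intro d
    induction d using Finsupp.induction with
    | zero =>
      intro _ y y' h
      rw [show y' = y from Subtype.ext (by simpa using h)]
      exact Relation.EqvGen.refl _
    | single_add a b f haf hb ih =>
      intro hd y y' h
      have hFa : F ≤ a.1 := by
        by_contra hcon
        have := hd a hcon
        simp [Finsupp.notMem_support_iff.1 haf, hb] at this
      have hf : ∀ a', ¬ F ≤ a'.1 → f a' = 0 := fun a' ha' => by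
        have := hd a' ha'
        have hne : a ≠ a' := fun he => ha' (he ▸ hFa)
        simpa [Finsupp.single_apply, hne] using this
      let z : Y := ⟨y.1 + f, fun a' ha' => by simp [y.2 a' ha', hf a' ha']⟩
      have hz : y'.1 = z.1 + Finsupp.single a b := by
        rw [h]; change _ = y.1 + f + _; abel
      refine (ih hf y z rfl).trans _ _ _ (Relation.EqvGen.rel _ _ ?_)
      -- In a flag through `a` all faces but the greatest lie below `a`, so the copies `z` and `y'`
      -- agree on them.
      obtain ⟨Ψ, hΨ⟩ := Flag.exists_mem (⟨a.1, hFa, le_top⟩ : Set.Icc F ⊤)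
      refine ⟨Ψ, n, flagAdj_extendFlag_of_agree _ _ hK.rank_top hK.rank_top (fun he => ?_) ?_⟩
      · have h1 := facetEmb_top_injective hK (congrArg Subtype.val he)
        have h2 := DFunLike.congr_fun (h1.trans hz) a
        simp [hb] at h2
      · intro s hs hst
        have hsa : s.1 ≤ a.1 := le_facet_of_comparable hK a
          (fun he => hst (Subtype.ext he)) (Ψ.le_or_le hs hΨ)
        refine Subtype.ext ?_
        rw [coe_sectionEmb, coe_sectionEmb, hz, facetEmb_add_single a hsa]

theorem isPolytope : IsPolytope (n + 1) (rank : ExtPoset n rk → ℤ) where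
  rank_strictMono := rank_strictMono hK
  rank_range := by
    ext j
    constructor
    · rintro ⟨t, rfl⟩
      refine ⟨?_, by simpa using rank_le hK t⟩
      rcases eq_top_or_exists t with rfl | ⟨x, F, rfl⟩
      · rw [rank_top]; omega
      · exact hK.neg_one_le_rank F
    · rintro ⟨h1, h2⟩
      rcases h2.eq_or_lt with h2 | h2
      · exact ⟨⊤, by rw [h2, rank_top]; simp⟩
      · push_cast at h2
        have : j ∈ Set.range rk := by
          rw [hK.rank_range]; constructor <;> omega
        obtain ⟨F, rfl⟩ := this
        exact ⟨facetEmb 0 F, rfl⟩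
  flag_card Θ := by
    obtain ⟨y, Ψ, rfl⟩ := exists_eq_extendFlag hK Θ
    rw [encard_extendFlag, hK.flag_card]
    push_cast
    ring
  diamond s t j hst hs ht := diamond hK s t j hst hs ht
  connected s t hst := by
    rcases eq_top_or_exists t with rfl | ⟨y, G, rfl⟩
    · rcases eq_top_or_exists s with rfl | ⟨x, F, rfl⟩
      · have : Subsingleton (Set.Icc (⊤ : ExtPoset n rk) ⊤) := by
          rw [Set.Icc_self]; infer_instance
        exact flagGraph_connected_of_subsingleton _
      · exact connected_section_top hK F x
    · obtain ⟨F, hF, rfl⟩ := exists_of_le_facetEmb hst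
      exact flagGraph_connected_of_orderIso (sectionIso y F G) (fun _ => rfl) (hK.connected F G hF)

theorem nonempty_facet_section (F : Facet (n + 1) (rank : ExtPoset n rk → ℤ)) :
    Nonempty (Set.Icc ⊥ F.1 ≃o K) := by
  obtain ⟨y, hy⟩ := exists_eq_of_isCoatom (((isPolytope hK).facet_iff_isCoatom F.1).1 F.2)
  -- Every facet of `K` contains `⊥`, so there is a single coset over `⊥` and the choice of `y` is
  -- immaterial.
  have hb : (⊥ : ExtPoset n rk) = facetEmb y ⊥ :=
    bot_le.antisymm (facetEmb_le.2 ⟨bot_le, fun a ha => absurd bot_le ha⟩ :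
      facetEmb y ⊥ ≤ facetEmb 0 ⊥)
  rw [← hy, hb]
  exact ⟨(sectionIso y ⊥ ⊤).symm.trans
    ⟨⟨fun x => x.1, fun x => ⟨x, bot_le, le_top⟩, fun _ => rfl, fun _ => rfl⟩, Iff.rfl⟩⟩

end Polytope

end ExtPoset

theorem flag_eq_of_subset {P : Type u} [PartialOrder P] {Φ Ψ : Flag P} (h : ∀ t ∈ Φ, t ∈ Ψ) :
    Φ = Ψ :=
  SetLike.coe_injective (Φ.maxChain.2 Ψ.chain_le h)

namespace ExtPoset

open ExtFace

variable {K : Type u} [PartialOrder K] [BoundedOrder K] {n : ℕ} {rk : K → ℤ}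

/-! ### The affine action of the semidirect product -/

section Action

variable (hK : IsPolytope n rk)

/-- The action of the automorphisms of `K` on sequences, written additively. -/
noncomputable def permute (σ : K ≃o K) : (Facet n rk →₀ ZMod 2) ≃+ (Facet n rk →₀ ZMod 2) :=
  Finsupp.domCongr (hK.facetPerm σ)

theorem permute_apply (σ : K ≃o K) (x : Facet n rk →₀ ZMod 2) (a : Facet n rk) :
    permute hK σ x a = x ((hK.facetPerm σ).symm a) := rfl

theorem permute_single (σ : K ≃o K) (a : Facet n rk) (b : ZMod 2) :
    permute hK σ (Finsupp.single a b) = Finsupp.single (hK.facetPerm σ a) b :=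
  Finsupp.equivMapDomain_single _ _ _

theorem permute_mul (σ τ : K ≃o K) (x : Facet n rk →₀ ZMod 2) :
    permute hK (σ * τ) x = permute hK σ (permute hK τ x) := by
  ext; rfl

theorem permute_one (x : Facet n rk →₀ ZMod 2) : permute hK 1 x = x := by
  ext; rfl

/-- The affine action of the semidirect product on sequences. -/
noncomputable def affine (g : C2Pow (Facet n rk) ⋊[hK.facetAction] (K ≃o K))
    (x : Facet n rk →₀ ZMod 2) : Facet n rk →₀ ZMod 2 :=
  g.left.toAdd + permute hK g.right x

theorem affine_mul (g h : C2Pow (Facet n rk) ⋊[hK.facetAction] (K ≃o K))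
    (x : Facet n rk →₀ ZMod 2) : affine hK (g * h) x = affine hK g (affine hK h x) := by
  rw [affine, affine, affine, SemidirectProduct.mul_left, SemidirectProduct.mul_right, permute_mul,
    map_add, ← add_assoc]
  rfl

theorem affine_one (x : Facet n rk →₀ ZMod 2) :
    affine hK (1 : C2Pow (Facet n rk) ⋊[hK.facetAction] (K ≃o K)) x = x := by
  rw [affine, SemidirectProduct.one_right, permute_one]
  exact zero_add x

/-- Well-definedness on cosets: `g.right` carries the facets containing `F` to those containing
`g.right F`. -/
theorem affine_agree (g : C2Pow (Facet n rk) ⋊[hK.facetAction] (K ≃o K)) {F : K}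
    {x y : Facet n rk →₀ ZMod 2} (h : ∀ a : Facet n rk, ¬ F ≤ a.1 → x a = y a) (a : Facet n rk)
    (ha : ¬ g.right F ≤ a.1) : affine hK g x a = affine hK g y a := by
  rw [affine, affine, Finsupp.add_apply, Finsupp.add_apply, permute_apply, permute_apply,
    h _ fun hle => ha ?_]
  exact (g.right.le_symm_apply).1 hle

/-- The action of the semidirect product on the proper faces of the extension. -/
noncomputable def actFace (g : C2Pow (Facet n rk) ⋊[hK.facetAction] (K ≃o K))
    (p : ExtFace n rk) : ExtFace n rk := of (g.right p.face) (affine hK g p.coord)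

theorem actFace_of (g : C2Pow (Facet n rk) ⋊[hK.facetAction] (K ≃o K)) (F : K)
    (x : Facet n rk →₀ ZMod 2) : actFace hK g (of F x) = of (g.right F) (affine hK g x) :=
  of_eq_of.2 ⟨rfl, affine_agree hK g fun _ ha => coord_of F x ha⟩

theorem actFace_monotone (g : C2Pow (Facet n rk) ⋊[hK.facetAction] (K ≃o K)) :
    Monotone (actFace hK g) := fun _ _ h =>
  of_le_of.2 ⟨g.right.monotone h.1, affine_agree hK g h.2⟩

theorem actFace_mul (g h : C2Pow (Facet n rk) ⋊[hK.facetAction] (K ≃o K)) (p : ExtFace n rk) :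
    actFace hK (g * h) p = actFace hK g (actFace hK h p) := by
  obtain ⟨F, x, rfl⟩ := exists_of p
  rw [actFace_of, actFace_of, actFace_of, affine_mul]
  rfl

theorem actFace_one (p : ExtFace n rk) :
    actFace hK (1 : C2Pow (Facet n rk) ⋊[hK.facetAction] (K ≃o K)) p = p := by
  obtain ⟨F, x, rfl⟩ := exists_of p
  rw [actFace_of, affine_one]
  rfl

noncomputable def actFaceIso (g : C2Pow (Facet n rk) ⋊[hK.facetAction] (K ≃o K)) :
    ExtFace n rk ≃o ExtFace n rk where
  toFun := actFace hK g
  invFun := actFace hK g⁻¹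
  left_inv p := by rw [← actFace_mul, inv_mul_cancel, actFace_one]
  right_inv p := by rw [← actFace_mul, mul_inv_cancel, actFace_one]
  map_rel_iff' {p q} := by
    refine ⟨fun h => ?_, fun h => actFace_monotone hK g h⟩
    have := actFace_monotone hK g⁻¹ h
    rwa [Equiv.coe_fn_mk, ← actFace_mul, ← actFace_mul, inv_mul_cancel, actFace_one,
      actFace_one] at this

/-- The action of the semidirect product on the extension. -/
noncomputable def act :
    C2Pow (Facet n rk) ⋊[hK.facetAction] (K ≃o K) →* (ExtPoset n rk ≃o ExtPoset n rk) :=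
  MonoidHom.mk' (fun g => (actFaceIso hK g).withTopCongr) fun g h => by
    ext t
    induction t using WithTop.recTopCoe with
    | top => rfl
    | coe p => exact congrArg _ (actFace_mul hK g h p)

theorem act_facetEmb (g : C2Pow (Facet n rk) ⋊[hK.facetAction] (K ≃o K)) (F : K)
    (x : Facet n rk →₀ ZMod 2) :
    act hK g (facetEmb x F) = facetEmb (affine hK g x) (g.right F) :=
  congrArg _ (actFace_of hK g F x)

theorem act_smul_extendFlag (g : C2Pow (Facet n rk) ⋊[hK.facetAction] (K ≃o K))
    (x : Facet n rk →₀ ZMod 2) (Ψ : Flag K) :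
    act hK g • extendFlag (isFacetEmb hK x) Ψ =
      extendFlag (isFacetEmb hK (affine hK g x)) (g.right • Ψ) := by
  refine flag_eq_of_subset ?_
  rintro _ ⟨t, rfl | ⟨F, hF, rfl⟩, rfl⟩
  · exact Or.inl (map_top (act hK g))
  · exact Or.inr ⟨g.right F, ⟨F, hF, rfl⟩, (act_facetEmb hK g F x).symm⟩

/-- On the copy of `K` with coordinates `0`, the underlying faces reveal `g.right` and the image of
the greatest face of the copy reveals the translation part. -/
theorem act_injective : Function.Injective (act hK) := by
  refine (injective_iff_map_eq_one _).2 fun g hg => ?_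
  have h : ∀ F, facetEmb (affine hK g 0) (g.right F) = (facetEmb 0 F : ExtPoset n rk) := fun F => by
    rw [← act_facetEmb, hg]; rfl
  refine SemidirectProduct.ext ?_ (RelIso.ext fun F => (facetEmb_eq.1 (h F)).1)
  have h1 := h ⊤
  rw [map_top] at h1
  have h2 := facetEmb_top_injective hK h1
  rw [affine, map_zero, add_zero] at h2
  exact h2

end Action

/-! ### Regularity and the full automorphism group -/

section Regular

variable (hK : IsRegularPolytope n rk)
include hK

theorem exists_act_smul_eq (Θ Θ' : Flag (ExtPoset n rk)) :
    ∃ g, act hK.toIsPolytope g • Θ = Θ' := by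
  obtain ⟨x, Ψ, rfl⟩ := exists_eq_extendFlag hK.toIsPolytope Θ
  obtain ⟨y, Ψ', rfl⟩ := exists_eq_extendFlag hK.toIsPolytope Θ'
  obtain ⟨σ, rfl⟩ := hK.flag_transitive Ψ Ψ'
  -- First match the flags of `K` by `σ`; the translation then corrects `σ x` to `y`.
  refine ⟨⟨Multiplicative.ofAdd (y - permute hK.toIsPolytope σ x), σ⟩, ?_⟩
  rw [act_smul_extendFlag]
  have : affine hK.toIsPolytope ⟨Multiplicative.ofAdd (y - permute hK.toIsPolytope σ x), σ⟩ x = y :=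
    sub_add_cancel _ _
  congr

theorem isRegularPolytope : IsRegularPolytope (n + 1) (rank : ExtPoset n rk → ℤ) where
  toIsPolytope := isPolytope hK.toIsPolytope
  flag_transitive Θ Θ' := by
    obtain ⟨g, hg⟩ := exists_act_smul_eq hK Θ Θ'
    exact ⟨_, hg⟩

/-- Given an automorphism, some group element has the same effect on one flag; by rigidity the two
coincide. -/
theorem act_bijective : Function.Bijective (act hK.toIsPolytope) := by
  refine ⟨act_injective _, fun τ => ?_⟩
  obtain ⟨Θ⟩ : Nonempty (Flag (ExtPoset n rk)) := inferInstance
  obtain ⟨g, hg⟩ := exists_act_smul_eq hK Θ (τ • Θ)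
  refine ⟨g, ?_⟩
  have := (isPolytope hK.toIsPolytope).eq_one_of_smul_eq (σ := τ⁻¹ * act hK.toIsPolytope g)
    (Φ := Θ) (by rw [mul_smul, hg, inv_smul_smul])
  exact (inv_mul_eq_one.1 this).symm

end Regular

/-! ### Schläfli type and finiteness -/

theorem period_map {G H : Type u} [Group G] [Group H] (f : G →* H) (hf : Function.Injective f)
    (g : G) : period (f g) = period g := by
  rw [period, period, orderOf_injective f hf]

theorem hasSchlafliType (hK : IsPolytope n rk) {p : ℕ → ℕ∞} (hp : HasSchlafliType n rk p) :
    HasSchlafliType (n + 1) (rank : ExtPoset n rk → ℤ) fun j => if j = n then 4 else p j := by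
  obtain ⟨Φ, ρ, hadj, hper⟩ := hp
  obtain ⟨F, hF, hFr⟩ := hK.exists_mem_flag Φ (j := (n : ℤ) - 1) (by omega) (by omega)
  let a : Facet n rk := ⟨F, hFr⟩
  let e : C2Pow (Facet n rk) := Multiplicative.ofAdd (Finsupp.single a 1)
  -- Of the values in the second branch only `j = n` matters. Translation by `e_a` changes just the
  -- facet of the base flag, since all its lower faces lie below `a`.
  let g : ℕ → C2Pow (Facet n rk) ⋊[hK.facetAction] (K ≃o K) := fun j =>
    if j < n then SemidirectProduct.inr (ρ j) else SemidirectProduct.inl e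
  refine ⟨extendFlag (isFacetEmb hK 0) Φ, fun j => act hK (g j), fun j hj => ?_,
    fun j h1 hj => ?_⟩
  · change FlagAdj _ _ _ (act hK (g j) • _)
    rw [act_smul_extendFlag]
    by_cases hjn : j < n
    · have hg : g j = SemidirectProduct.inr (ρ j) := if_pos hjn
      have h0 : affine hK (g j) 0 = 0 := by
        rw [hg, affine, map_zero]; rfl
      rw [hg] at h0 ⊢
      simp only [h0]
      exact (hadj j hjn).extendFlag _ fun _ => rfl
    · have hg : g j = SemidirectProduct.inl e := if_neg hjn
      have h0 : affine hK (g j) 0 = 0 + Finsupp.single a 1 := by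
        rw [hg, affine, map_zero, add_zero, zero_add]; rfl
      have hj' : j = n := by omega
      subst hj'
      rw [hg] at h0 ⊢
      simp only [h0, SemidirectProduct.right_inl, one_smul]
      refine flagAdj_extendFlag_of_agree _ _ hK.rank_top hK.rank_top (fun he => ?_) ?_
      · have := DFunLike.congr_fun (facetEmb_top_injective hK he) a
        simp at this
      · intro s hs hst
        exact (facetEmb_add_single a
          (le_facet_of_comparable hK a hst (Φ.le_or_le hs hF)) 0 1).symm
  · change period (act hK (g (j - 1)) * act hK (g j)) = _
    rw [← map_mul, period_map _ (act_injective hK)]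
    beta_reduce
    have hg1 : g (j - 1) = SemidirectProduct.inr (ρ (j - 1)) := if_pos (by omega)
    by_cases hjn : j < n
    · have hg : g j = SemidirectProduct.inr (ρ j) := if_pos hjn
      rw [hg1, hg, ← map_mul, period_map _ SemidirectProduct.inr_injective, if_neg hjn.ne]
      exact hper j h1 hjn
    · have hg : g j = SemidirectProduct.inl e := if_neg hjn
      have hj' : j = n := by omega
      rw [hg1, hg, if_pos hj']
      set σ := ρ (j - 1) with hσ
      have hadj' := hadj (j - 1) (by omega)
      have hrank : ((j - 1 : ℕ) : ℤ) = (n : ℤ) - 1 := by omega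
      rw [← hσ, hrank] at hadj'
      have hinv : σ * σ = 1 := by
        refine hK.eq_one_of_smul_eq (Φ := Φ) ?_
        have hmap : FlagAdj rk _ (σ • Φ) (σ • σ • Φ) := hadj'.map σ (hK.rank_map σ)
        rw [mul_smul]
        exact hK.flagAdj_unique hmap ⟨hadj'.1.symm, fun G hG => (hadj'.2 G hG).symm⟩
      -- If `σ` fixed the base facet, it would fix the whole base flag, contrary to adjacency.
      have hne : hK.facetPerm σ a ≠ a := fun he => by
        have hFσ : σ F = F := congrArg Subtype.val he
        refine hadj'.1 (flag_eq_of_subset fun G hG => ?_)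
        by_cases hr : rk G = (n : ℤ) - 1
        · rw [hK.eq_of_mem_flag Φ hG hF (hr.trans hFr.symm)]
          exact ⟨F, hF, hFσ⟩
        · exact (hadj'.2 G hr).1 hG
      let d : C2Pow (Facet n rk) := hK.facetAction σ e * e
      -- Moving `σ` past `e` turns `σ e σ e` into `(σ • e) σ² e`, and `σ² = 1`.
      have hsq : (SemidirectProduct.inr σ * SemidirectProduct.inl e :
          C2Pow (Facet n rk) ⋊[hK.facetAction] (K ≃o K)) ^ 2 = SemidirectProduct.inl d := by
        rw [pow_two]
        refine SemidirectProduct.ext ?_ ?_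
        · have hσe : hK.facetAction σ (hK.facetAction σ e) = e := by
            rw [← MulAut.mul_apply, ← map_mul, hinv, map_one, MulAut.one_apply]
          simp [d, hσe]
        · simpa using hinv
      have hd : d ≠ 1 := fun he => by
        have h2 : (Finsupp.single (hK.facetPerm σ a) 1 + Finsupp.single a 1 :
            Facet n rk →₀ ZMod 2) = 0 := by
          rw [← permute_single]; exact he
        have := DFunLike.congr_fun h2 a
        simp [hne] at this
      have hdd : d ^ 2 = 1 := by
        rw [pow_two]
        exact (Finsupp.ext fun a => CharTwo.add_self_eq_zero _ : d.toAdd + d.toAdd = 0)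
      have ho : orderOf (SemidirectProduct.inr σ * SemidirectProduct.inl e :
          C2Pow (Facet n rk) ⋊[hK.facetAction] (K ≃o K)) = 2 ^ (1 + 1) := by
        refine orderOf_eq_prime_pow ?_ ?_
        · rw [pow_one, hsq]
          exact fun h => hd (SemidirectProduct.inl_injective (h.trans (map_one _).symm))
        · rw [pow_succ, pow_mul, pow_one, hsq, ← map_pow, hdd, map_one]
      rw [period, ho]
      norm_num

omit [BoundedOrder K] in
theorem finite_iff : Finite (ExtPoset n rk) ↔ Finite K := by
  constructor
  · intro _
    exact Finite.of_injective _ (facetEmb (0 : Facet n rk →₀ ZMod 2)).injective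
  · intro _
    exact inferInstanceAs (Finite (Option (ExtFace n rk)))

end ExtPoset

theorem card_C2Pow (A : Type u) [Finite A] : Nat.card (C2Pow A) = 2 ^ Nat.card A := by
  have := Fintype.ofFinite A
  rw [Nat.card_congr (Multiplicative.toAdd.trans Finsupp.equivFunOnFinite), Nat.card_fun]
  simp

end AbsPoly

theorem lemma3p1 (m : ℕ) {K : Type u} [PartialOrder K] [BoundedOrder K] (rk : K → ℤ)
    (hK : AbsPoly.IsRegularPolytope m rk) (p : ℕ → ℕ∞)
    (hp : AbsPoly.HasSchlafliType m rk p) :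
    ∃ (L : Type u) (_ : PartialOrder L) (_ : BoundedOrder L) (rkL : L → ℤ),
      AbsPoly.IsRegularPolytope (m + 1) rkL ∧
      AbsPoly.HasSchlafliType (m + 1) rkL (fun j => if j = m then 4 else p j) ∧
      (∀ F : AbsPoly.Facet (m + 1) rkL, Nonempty (Set.Icc (⊥ : L) F.1 ≃o K)) ∧
      Nonempty ((L ≃o L) ≃*
        AbsPoly.C2Pow (AbsPoly.Facet m rk) ⋊[hK.toIsPolytope.facetAction] (K ≃o K)) ∧
      (Finite K →
        Nat.card (L ≃o L) = Nat.card (K ≃o K) * 2 ^ Nat.card (AbsPoly.Facet m rk)) ∧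
      (Finite L ↔ Finite K) := by
  have e := (MulEquiv.ofBijective _ (AbsPoly.ExtPoset.act_bijective hK)).symm
  refine ⟨AbsPoly.ExtPoset m rk, inferInstance, inferInstance, AbsPoly.ExtPoset.rank,
    AbsPoly.ExtPoset.isRegularPolytope hK, AbsPoly.ExtPoset.hasSchlafliType hK.toIsPolytope hp,
    AbsPoly.ExtPoset.nonempty_facet_section hK.toIsPolytope, ⟨e⟩, fun _ => ?_,
    AbsPoly.ExtPoset.finite_iff⟩
  rw [Nat.card_congr e.toEquiv, SemidirectProduct.card, AbsPoly.card_C2Pow, mul_comm]
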